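/- **Colorful Steinitz Lemma.** Let $d, m, n$ be natural numbers, let $\|\cdot\|:\mathbb{R}^d\to\mathbb{R}$ be an arbitrary norm, and let $\mathcal{U}=\{x\in\mathbb{R}^d : \|x\|\le 1\}$ be its unit ball. Let $(u_1^i)_{i=1}^m,\ldots,(u_n^i)_{i=1}^m$ be $n$ sequences of length $m$ in $\mathcal{U}$ whose union is a zero-sum sequence, that is, $\sum_{j=1}^n\sum_{i=1}^m u_j^i=0$. Then there exist permutations $\pi_1,\ldots,\pi_n$ of $\{1,\ldots,m\}$ such that $$\left\|\sum_{i=1}^k\sum_{j=1}^n u_j^{\pi_j(i)}\right\|\le\min\{nd,\,40d^5\}$$ for each $k\in\{1,\ldots,m\}$. -/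

import Mathlib

/-! Two listings give the two bounds. For `n * d`, each color is rearranged by the Steinitz lemma so
that its partial sums follow a multiple of its own total; the multiple depends only on `k`, so over
all colors these corrections cancel. For `40 * d ^ 5`, the color classes are repeatedly split into
near halves whose sums stay bounded by `6 * d`, until transversals remain. Steinitz applied to the
transversal sums then gives `6 * d ^ 2`. Both rest on one fact: a vertex of a polytope cut from the
cube by linear equations has at most as many fractional coordinates as there are independent
equations. -/

/-! ### Vertices of sections of the cube -/

open Finset in
/-- A point of the cube can be moved, keeping its integral coordinates and its image under a linear
map `L`, to a point where no nonzero vector supported on the fractional coordinates lies in the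
kernel of `L`. -/
theorem exists_basic_point_of_mem_cube {ι W : Type*} [Fintype ι] [AddCommGroup W] [Module ℝ W]
    (L : (ι → ℝ) →ₗ[ℝ] W) (x : ι → ℝ) (hx : ∀ i, x i ∈ Set.Icc (0 : ℝ) 1) :
    ∃ y : ι → ℝ, (∀ i, y i ∈ Set.Icc (0 : ℝ) 1) ∧ L y = L x ∧ (∀ i, x i = 0 → y i = 0) ∧
      (∀ i, x i = 1 → y i = 1) ∧
      ∀ z : ι → ℝ, L z = 0 → (∀ i, z i ≠ 0 → y i ∈ Set.Ioo (0 : ℝ) 1) → z = 0 := by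
  classical
  induction hN : #{i | x i ∈ Set.Ioo (0 : ℝ) 1} using Nat.strong_induction_on generalizing x with
  | _ N ih =>
  by_cases hz : ∀ z : ι → ℝ, L z = 0 → (∀ i, z i ≠ 0 → x i ∈ Set.Ioo (0 : ℝ) 1) → z = 0
  · exact ⟨x, hx, rfl, fun _ h => h, fun _ h => h, hz⟩
  push Not at hz
  obtain ⟨z, hLz, hsupp, hz0⟩ := hz
  -- The longest step along `z` that keeps coordinate `i` in the unit interval; taking the minimum
  -- over the support makes a fractional coordinate integral.
  set τ : ι → ℝ := fun i => if 0 < z i then (1 - x i) / z i else x i / (-z i) with hτ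
  obtain ⟨i₁, hi₁⟩ : ∃ i, z i ≠ 0 := Function.ne_iff.mp hz0
  obtain ⟨i₀, hi₀, hmin⟩ := exists_min_image ({i | z i ≠ 0} : Finset ι) τ ⟨i₁, by simpa using hi₁⟩
  simp only [mem_filter, mem_univ, true_and] at hi₀ hmin
  have hτ0 : 0 ≤ τ i₀ := by
    have h := hsupp i₀ hi₀
    simp only [hτ]
    split_ifs with hpos
    · exact div_nonneg (by linarith [h.2]) hpos.le
    · exact div_nonneg h.1.le (by linarith)
  have hstep : ∀ i, x i + τ i₀ * z i ∈ Set.Icc (0 : ℝ) 1 := by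
    intro i
    have hxi := hx i
    rcases lt_trichotomy (z i) 0 with h | h | h
    · have h1 := hmin i h.ne
      simp only [hτ] at h1
      rw [if_neg (not_lt.mpr h.le), le_div_iff₀ (by linarith)] at h1
      simp only [hτ] at hτ0 ⊢
      constructor
      · linarith
      · nlinarith [hxi.2]
    · rw [h]; simpa using hxi
    · have h1 := hmin i h.ne'
      simp only [hτ] at h1
      rw [if_pos h, le_div_iff₀ h] at h1
      simp only [hτ] at hτ0 ⊢
      constructor
      · nlinarith [hxi.1]
      · linarith
  have hfix : ∀ i, x i ∉ Set.Ioo (0 : ℝ) 1 → x i + τ i₀ * z i = x i := by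
    intro i hi
    have : z i = 0 := by
      by_contra h
      exact hi (hsupp i h)
    simp [this]
  have hhit : x i₀ + τ i₀ * z i₀ ∉ Set.Ioo (0 : ℝ) 1 := by
    intro h
    simp only [hτ] at h
    split_ifs at h with hpos
    · rw [div_mul_cancel₀ _ hi₀] at h
      linarith [h.2]
    · have : x i₀ / -z i₀ * z i₀ = - x i₀ := by field_simp
      rw [this] at h
      linarith [h.1]
  obtain ⟨y, hy, hLy, h0, h1, hker⟩ := ih _ (by
    rw [← hN]
    apply card_lt_card
    rw [ssubset_iff_of_subset]
    · refine ⟨i₀, by simpa using hsupp i₀ hi₀, by simpa using hhit⟩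
    · intro i hi
      simp only [mem_filter, mem_univ, true_and] at hi ⊢
      by_contra hc
      rw [hfix i hc] at hi
      exact hc hi) (fun i => x i + τ i₀ * z i) hstep rfl
  refine ⟨y, hy, ?_, fun i hi => h0 i ?_, fun i hi => h1 i ?_, hker⟩
  · rw [hLy]
    have : (fun i => x i + τ i₀ * z i) = x + τ i₀ • z := by ext i; simp
    rw [this, map_add, map_smul, hLz]; simp
  · rw [hfix i (by simp [hi]), hi]
  · rw [hfix i (by simp [hi]), hi]

/-- A vector supported on `F` is determined by a linear map into `W` that is injective on such
vectors, so `F` has at most `finrank W` elements. -/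
theorem card_le_finrank_of_ker_trivial_on_support {ι W : Type*} [Fintype ι] [AddCommGroup W]
    [Module ℝ W] [FiniteDimensional ℝ W] (L : (ι → ℝ) →ₗ[ℝ] W) (F : Finset ι)
    (h : ∀ z : ι → ℝ, L z = 0 → (∀ i, z i ≠ 0 → i ∈ F) → z = 0) :
    F.card ≤ Module.finrank ℝ W := by
  classical
  let E : (F → ℝ) →ₗ[ℝ] (ι → ℝ) :=
    { toFun := fun g i => if hi : i ∈ F then g ⟨i, hi⟩ else 0
      map_add' := by intro a b; ext i; by_cases hi : i ∈ F <;> simp [hi]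
      map_smul' := by intro a b; ext i; by_cases hi : i ∈ F <;> simp [hi] }
  have hinj : Function.Injective (L ∘ₗ E) := by
    rw [← LinearMap.ker_eq_bot, LinearMap.ker_eq_bot']
    intro g hg
    have := h (E g) hg (fun i hi => by
      by_contra hc
      exact hi (by simp [E, hc]))
    ext ⟨i, hi⟩
    simpa [E, hi] using congrFun this i
  simpa using LinearMap.finrank_le_finrank_of_injective hinj

/-! ### The Steinitz lemma -/

open Finset in
/-- If a property of finite sets holds for the full set and survives the removal of a suitable
element, then the elements can be listed so that all initial segments have the property. -/
theorem exists_perm_forall_image_Iic {m : ℕ} (Q : Finset (Fin m) → Prop) (huniv : Q univ)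
    (hstep : ∀ A, A.Nonempty → Q A → ∃ a ∈ A, Q (A.erase a)) :
    ∃ π : Equiv.Perm (Fin m), ∀ k, Q ((Iic k).map π.toEmbedding) := by
  classical
  have key : ∀ (a : ℕ) (A : Finset (Fin m)), #A = a → Q A →
      ∃ f : Fin a → Fin m, Function.Injective f ∧ (∀ i, f i ∈ A) ∧
        ∀ k, Q ((Iic k).image f) := by
    intro a
    induction a with
    | zero => exact fun A _ _ => ⟨Fin.elim0, fun i => i.elim0, fun i => i.elim0, fun i => i.elim0⟩
    | succ a ih =>
      intro A hA hQ
      obtain ⟨c, hc, hQc⟩ := hstep A (card_pos.mp (by omega)) hQ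
      obtain ⟨f, hinj, hmem, hf⟩ := ih (A.erase c) (by rw [card_erase_of_mem hc]; omega) hQc
      have hinj' : Function.Injective (Fin.snoc f c : Fin (a + 1) → Fin m) :=
        Fin.snoc_injective_iff.mpr ⟨hinj, by
          rintro ⟨i, hi⟩
          exact (mem_erase.mp (hmem i)).1 hi⟩
      have hmem' : ∀ i, (Fin.snoc f c : Fin (a + 1) → Fin m) i ∈ A := by
        intro i
        refine Fin.lastCases ?_ (fun i => ?_) i
        · simpa using hc
        · simpa using (mem_erase.mp (hmem i)).2
      refine ⟨Fin.snoc f c, hinj', hmem', fun k => ?_⟩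
      refine Fin.lastCases ?_ (fun k => ?_) k
      · have : (Iic (Fin.last a)).image (Fin.snoc f c : Fin (a + 1) → Fin m) = A := by
          apply eq_of_subset_of_card_le
          · intro x hx
            obtain ⟨i, -, rfl⟩ := mem_image.mp hx
            exact hmem' i
          · rw [card_image_of_injective _ hinj']
            simp [hA]
        rwa [this]
      · have : (Iic k.castSucc).image (Fin.snoc f c : Fin (a + 1) → Fin m) = (Iic k).image f := by
          rw [← Fin.map_castSuccEmb_Iic, map_eq_image, image_image]
          congr 1
          ext i
          simp
        rw [this]
        exact hf k
  obtain ⟨f, hinj, -, hf⟩ := key m univ (by simp) huniv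
  refine ⟨Equiv.ofBijective f (Finite.injective_iff_bijective.mp hinj), fun k => ?_⟩
  rw [map_eq_image]
  exact hf k

open Finset in
/-- Grinberg and Sevastyanov's form of the Steinitz lemma, for a sequence of arbitrary sum: the
partial sums of a suitable rearrangement stay within `d * M` of points of the segment from `0` to
the sum that depend only on the lengths. -/
theorem exists_perm_seminorm_partial_sum_sub_le {E : Type*} [AddCommGroup E] [Module ℝ E]
    [FiniteDimensional ℝ E] (p : Seminorm ℝ E) {m : ℕ} {M : ℝ} (hM : 0 ≤ M) (v : Fin m → E)
    (hv : ∀ i, p (v i) ≤ M) :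
    ∃ π : Equiv.Perm (Fin m), ∀ k : Fin m,
      p (∑ i ∈ Iic k, v (π i) -
        (((k + 1 - Module.finrank ℝ E : ℕ) : ℝ) / m) • ∑ i, v i) ≤ Module.finrank ℝ E * M := by
  classical
  set d := Module.finrank ℝ E with hd
  -- The truncated subtraction makes the required weight zero once at most `d` elements remain.
  let Q : Finset (Fin m) → Prop := fun A => ∃ l : Fin m → ℝ, (∀ i, l i ∈ Set.Icc (0 : ℝ) 1) ∧
    (∀ i, i ∉ A → l i = 0) ∧ ∑ i, l i = (#A - d : ℕ) ∧
    ∑ i, l i • v i = (((#A - d : ℕ) : ℝ) / m) • ∑ i, v i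
  have huniv : Q univ := by
    refine ⟨fun _ => ((m - d : ℕ) : ℝ) / m, fun i => ⟨by positivity, ?_⟩, by simp, ?_, ?_⟩
    · apply div_le_one_of_le₀ _ (by positivity)
      exact_mod_cast Nat.sub_le m d
    · rcases Nat.eq_zero_or_pos m with rfl | hm
      · simp
      · have : (m : ℝ) ≠ 0 := by positivity
        simp only [sum_const, card_univ, Fintype.card_fin, nsmul_eq_mul]
        field_simp
    · simp [← smul_sum]
  have hstep : ∀ A : Finset (Fin m), A.Nonempty → Q A → ∃ a ∈ A, Q (A.erase a) := by
    rintro A ⟨a, ha⟩ ⟨l, hl, hlA, hlsum, hlv⟩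
    rcases le_or_gt (#A) d with hAd | hAd
    · refine ⟨a, ha, 0, by simp, by simp, ?_⟩
      have : #(A.erase a) - d = 0 := by rw [card_erase_of_mem ha]; omega
      simp [this]
    obtain ⟨r, hr⟩ : ∃ r, #A = d + r + 1 := ⟨#A - d - 1, by omega⟩
    have hr1 : #A - d = r + 1 := by omega
    rw [hr1] at hlsum hlv
    -- Scaling by `c` lowers the total weight by one, as needed after a removal; passing to a vertex
    -- then frees an element of weight zero.
    set c : ℝ := (r : ℝ) / (r + 1) with hc
    have hc0 : 0 ≤ c := by positivity
    have hc1 : c ≤ 1 := div_le_one_of_le₀ (by linarith) (by positivity)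
    have hcr : c * ((r + 1 : ℕ) : ℝ) = r := by rw [hc]; push_cast; field_simp
    let L : (Fin m → ℝ) →ₗ[ℝ] E × ℝ :=
      (Fintype.linearCombination ℝ v).prod (Fintype.linearCombination ℝ (fun _ => (1 : ℝ)))
    have hL : ∀ x, L x = (∑ i, x i • v i, ∑ i, x i) := fun x =>
      Prod.ext rfl (by simp [L, Function.prod, Fintype.linearCombination_apply])
    obtain ⟨y, hy, hLy, hy0, -, hker⟩ := exists_basic_point_of_mem_cube L (fun i => c * l i)
      (fun i => ⟨mul_nonneg hc0 (hl i).1, mul_le_one₀ hc1 (hl i).1 (hl i).2⟩)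
    have hyA : ∀ i, i ∉ A → y i = 0 := fun i hi => hy0 i (by rw [hlA i hi, mul_zero])
    have hysum : ∑ i, y i = r := by
      rw [hL, hL] at hLy
      have := congrArg Prod.snd hLy
      simp only [← mul_sum, hlsum] at this
      rw [this, hcr]
    have hyv : ∑ i, y i • v i = ((r : ℝ) / m) • ∑ i, v i := by
      rw [hL, hL] at hLy
      have := congrArg Prod.fst hLy
      simp only [mul_smul, ← smul_sum, hlv] at this
      rw [this, smul_smul, ← mul_div_assoc, hcr]
    have hF := card_le_finrank_of_ker_trivial_on_support L {i | y i ∈ Set.Ioo (0 : ℝ) 1}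
      (fun z hz hs => hker z hz (fun i hi => by simpa using hs i hi))
    rw [Module.finrank_prod, Module.finrank_self, ← hd] at hF
    -- Otherwise the deficits `1 - y i` sum to `d + 1` over fractional coordinates only, each being
    -- less than one, so there would be more than `d + 1` of these.
    obtain ⟨b, hbA, hb⟩ : ∃ b ∈ A, y b = 0 := by
      by_contra! hne
      have hpos : ∀ i ∈ A, 0 < y i := fun i hi => lt_of_le_of_ne (hy i).1 (hne i hi).symm
      have h1 : ∑ i ∈ A, (1 - y i) = d + 1 := by
        have : ∑ i ∈ A, y i = r := by
          rw [← hysum]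
          exact sum_subset (subset_univ _) (fun i _ hi => hyA i hi)
        rw [sum_sub_distrib, this]
        simp [hr]
        ring
      have h2 : ∑ i ∈ A, (1 - y i) = ∑ i with y i ∈ Set.Ioo (0 : ℝ) 1, (1 - y i) := by
        symm
        apply sum_subset
        · intro i hi
          by_contra hc
          simp [hyA i hc] at hi
        · intro i hi hni
          simp only [mem_filter, mem_univ, true_and, Set.mem_Ioo, not_and, not_lt] at hni
          linarith [hni (hpos i hi), (hy i).2]
      have hne : ({i | y i ∈ Set.Ioo (0 : ℝ) 1} : Finset (Fin m)).Nonempty := by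
        by_contra hc
        rw [not_nonempty_iff_eq_empty.mp hc, sum_empty] at h2
        rw [h2] at h1
        have : (0 : ℝ) ≤ d := by positivity
        linarith
      have h3 : ∑ i with y i ∈ Set.Ioo (0 : ℝ) 1, (1 - y i) <
          ∑ i with y i ∈ Set.Ioo (0 : ℝ) 1, (1 : ℝ) := by
        apply sum_lt_sum_of_nonempty hne
        intro i hi
        simp only [mem_filter, mem_univ, true_and] at hi
        linarith [hi.1]
      rw [← h2, h1, sum_const, nsmul_eq_mul, mul_one] at h3
      have : d + 1 < #{i | y i ∈ Set.Ioo (0 : ℝ) 1} := by exact_mod_cast h3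
      omega
    have hcard : #(A.erase b) - d = r := by rw [card_erase_of_mem hbA]; omega
    refine ⟨b, hbA, y, hy, fun i hi => ?_, by rw [hcard, hysum], by rw [hcard, hyv]⟩
    by_cases hib : i = b
    · rw [hib, hb]
    · exact hyA i (fun h => hi (mem_erase.mpr ⟨hib, h⟩))
  obtain ⟨π, hπ⟩ := exists_perm_forall_image_Iic Q huniv hstep
  refine ⟨π, fun k => ?_⟩
  obtain ⟨l, hl, hlA, hlsum, hlv⟩ := hπ k
  set A := (Iic k).map π.toEmbedding with hA
  have hcard : #A = k + 1 := by simp [hA]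
  rw [hcard] at hlsum hlv
  have h1 : ∑ i ∈ Iic k, v (π i) = ∑ i ∈ A, v i := by simp [hA]
  have h2 : ∑ i, l i • v i = ∑ i ∈ A, l i • v i :=
    (sum_subset (subset_univ _) (fun i _ hi => by rw [hlA i hi, zero_smul])).symm
  have h3 : ∑ i, l i = ∑ i ∈ A, l i :=
    (sum_subset (subset_univ _) (fun i _ hi => hlA i hi)).symm
  -- The error is a combination with coefficients `1 - l i`, whose total is at most `d`.
  rw [← hlv, h1, h2, ← sum_sub_distrib]
  calc p (∑ i ∈ A, (v i - l i • v i)) ≤ ∑ i ∈ A, p (v i - l i • v i) := 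
        le_sum_of_subadditive p (map_zero p).le (map_add_le_add p) _ _
    _ ≤ ∑ i ∈ A, (1 - l i) * M := by
        apply sum_le_sum
        intro i _
        have h0 : 0 ≤ 1 - l i := by linarith [(hl i).2]
        have : v i - l i • v i = (1 - l i) • v i := by rw [sub_smul, one_smul]
        rw [this, map_smul_eq_mul, Real.norm_of_nonneg h0]
        exact mul_le_mul_of_nonneg_left (hv i) h0
    _ = (((k + 1 : ℕ) : ℝ) - ((k + 1 - d : ℕ) : ℝ)) * M := by
        rw [← sum_mul, sum_sub_distrib, ← h3, hlsum]
        simp [hcard]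
    _ ≤ d * M := by
        apply mul_le_mul_of_nonneg_right _ hM
        have : k + 1 ≤ (k + 1 - d : ℕ) + d := by omega
        have : ((k + 1 : ℕ) : ℝ) ≤ ((k + 1 - d : ℕ) : ℝ) + d := by exact_mod_cast this
        linarith

/-! ### Balanced splitting of color classes -/

open Finset in
/-- From color classes of equal size `b + b'` one can select `b` elements each, so that the sum of
all selected vectors differs from the proportional share of the total sum by at most twice the
dimension, whatever the number of colors. -/
theorem exists_balanced_selection {κ ι E : Type*} [Fintype κ] [Fintype ι] [DecidableEq ι]
    [AddCommGroup E] [Module ℝ E] [FiniteDimensional ℝ E] (p : Seminorm ℝ E) (u : κ → ι → E)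
    (hu : ∀ j i, p (u j i) ≤ 1) (b b' : ℕ) (hb : 0 < b + b') (A : κ → Finset ι)
    (hA : ∀ j, #(A j) = b + b') :
    ∃ B : κ → Finset ι, (∀ j, B j ⊆ A j) ∧ (∀ j, #(B j) = b) ∧
      p (∑ j, ∑ i ∈ B j, u j i - ((b : ℝ) / (b + b')) • ∑ j, ∑ i ∈ A j, u j i) ≤
        2 * Module.finrank ℝ E := by
  classical
  have hbpos : (0 : ℝ) < (b : ℝ) + b' := by exact_mod_cast hb
  set c : ℝ := (b : ℝ) / (b + b') with hc
  have hc01 : c ∈ Set.Icc (0 : ℝ) 1 :=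
    ⟨by positivity, div_le_one_of_le₀ (le_add_of_nonneg_right (Nat.cast_nonneg b')) hbpos.le⟩
  let L : (κ × ι → ℝ) →ₗ[ℝ] E × (κ → ℝ) :=
    { toFun := fun x => (∑ j, ∑ i, x (j, i) • u j i, fun j => ∑ i, x (j, i))
      map_add' := fun x y => by
        ext <;> simp [add_smul, sum_add_distrib]
      map_smul' := fun t x => by
        ext <;> simp [mul_smul, smul_sum, mul_sum] }
  obtain ⟨y, hy, hLy, hy0, -, hker⟩ := exists_basic_point_of_mem_cube L
    (fun q => if q.2 ∈ A q.1 then c else 0) (fun q => by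
      split_ifs
      · exact hc01
      · simp)
  have hyA : ∀ j i, i ∉ A j → y (j, i) = 0 := fun j i hi => hy0 (j, i) (by simp [hi])
  have hyv : ∑ j, ∑ i, y (j, i) • u j i = c • ∑ j, ∑ i ∈ A j, u j i := by
    have := congrArg Prod.fst hLy
    simp only [L, LinearMap.coe_mk, AddHom.coe_mk, ite_smul, zero_smul, sum_ite_mem, univ_inter,
      ← smul_sum] at this
    exact this
  have hysum : ∀ j, ∑ i, y (j, i) = b := by
    intro j
    have := congrFun (congrArg Prod.snd hLy) j
    simp only [L, LinearMap.coe_mk, AddHom.coe_mk, sum_ite_mem, univ_inter, sum_const, hA,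
      nsmul_eq_mul] at this
    rw [this, hc]
    push_cast
    field_simp
  set F : Finset (κ × ι) := {q | y q ∈ Set.Ioo (0 : ℝ) 1} with hF
  have hmemF : ∀ q, q ∈ F ↔ y q ∈ Set.Ioo (0 : ℝ) 1 := by simp [hF]
  have hint : ∀ q, q ∉ F → y q = 0 ∨ y q = 1 := by
    intro q hq
    by_contra! h
    exact hq ((hmemF q).mpr ⟨(hy q).1.lt_of_ne' h.1, (hy q).2.lt_of_ne h.2⟩)
  set J := F.image Prod.fst with hJ
  -- Only the cardinality equations of colors in `J` count: the others hold trivially for vectors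
  -- supported on `F`.
  have hFJ : #F ≤ Module.finrank ℝ E + #J := by
    have := card_le_finrank_of_ker_trivial_on_support
      ((LinearMap.id.prodMap (LinearMap.funLeft ℝ ℝ (Subtype.val : J → κ))) ∘ₗ L) F
      (fun z hz hs => by
        refine hker z ?_ (fun q hq => (hmemF q).mp (hs q hq))
        refine Prod.ext (congrArg Prod.fst hz :) (funext fun j => ?_)
        by_cases hj : j ∈ J
        · exact congrFun (congrArg Prod.snd hz) ⟨j, hj⟩
        · refine sum_eq_zero fun i _ => ?_
          by_contra hne
          exact hj (mem_image_of_mem Prod.fst (hs (j, i) hne)))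
    simpa [Module.finrank_prod] using this
  -- A color cannot have exactly one fractional coordinate, since its sum `b` is an integer. With
  -- `hFJ` this bounds `#F` by twice the dimension, independently of the number of colors.
  have hJF : 2 * #J ≤ #F := by
    apply mul_card_image_le_card
    intro j hj
    obtain ⟨⟨j', i⟩, hi, rfl⟩ := mem_image.mp hj
    by_contra hlt
    have honly : ∀ i', i' ≠ i → (j', i') ∉ F := by
      intro i' hne hi'
      have : 1 < #{q ∈ F | q.1 = j'} := one_lt_card.mpr
        ⟨(j', i'), by simp [hi'], (j', i), by simp [hi], by simp [hne]⟩
      exact hlt this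
    have h1 : ∑ i' ∈ univ.erase i, y (j', i') = #{i' ∈ univ.erase i | y (j', i') = 1} := by
      rw [card_filter, Nat.cast_sum]
      refine sum_congr rfl fun i' hi' => ?_
      rcases hint _ (honly i' (mem_erase.mp hi').1) with h | h <;> simp [h]
    have h2 := add_sum_erase univ (fun i' => y (j', i')) (mem_univ i)
    rw [h1, hysum] at h2
    have h3 := (hmemF _).mp hi
    set N := #{i' ∈ univ.erase i | y (j', i') = 1}
    have h4 : (N : ℝ) < b := by linarith [h3.1]
    have h5 : (b : ℝ) < (N + 1 : ℕ) := by push_cast; linarith [h3.2]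
    have h4' : N < b := by exact_mod_cast h4
    have h5' : b < N + 1 := by exact_mod_cast h5
    omega
  -- Rounding keeps ones and drops zeros, so only coordinates in `F` change, each by at most one.
  have hsel : ∀ j, ∃ B : Finset ι, ({i | y (j, i) = 1} : Finset ι) ⊆ B ∧
      B ⊆ ({i | 0 < y (j, i)} : Finset ι) ∧ #B = b := by
    intro j
    apply exists_subsuperset_card_eq
    · intro i hi
      simp only [mem_filter, mem_univ, true_and] at hi ⊢
      rw [hi]; exact one_pos
    · have : (#{i | y (j, i) = 1} : ℝ) ≤ b := by
        rw [← hysum j, card_filter, Nat.cast_sum]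
        refine sum_le_sum fun i _ => ?_
        split_ifs with h
        · simp [h]
        · simpa using (hy (j, i)).1
      exact_mod_cast this
    · have : (b : ℝ) ≤ #{i | 0 < y (j, i)} := by
        rw [← hysum j, card_filter, Nat.cast_sum]
        refine sum_le_sum fun i _ => ?_
        split_ifs with h
        · simpa using (hy (j, i)).2
        · simpa using h
      exact_mod_cast this
  choose B hB1 hB0 hBcard using hsel
  refine ⟨B, fun j i hi => ?_, hBcard, ?_⟩
  · by_contra h
    have := hB0 j hi
    simp [hyA j i h] at this
  have hrep : ∑ j, ∑ i ∈ B j, u j i - c • ∑ j, ∑ i ∈ A j, u j i =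
      ∑ q : κ × ι, ((if q.2 ∈ B q.1 then 1 else 0) - y q) • u q.1 q.2 := by
    rw [← hyv, Fintype.sum_prod_type]
    simp [sub_smul, sum_sub_distrib, ite_smul]
  rw [hrep]
  calc _ ≤ ∑ q : κ × ι, p (((if q.2 ∈ B q.1 then 1 else 0) - y q) • u q.1 q.2) :=
        le_sum_of_subadditive p (map_zero p).le (map_add_le_add p) _ _
    _ ≤ ∑ q : κ × ι, if q ∈ F then (1 : ℝ) else 0 := by
        refine sum_le_sum fun q _ => ?_
        rw [map_smul_eq_mul, Real.norm_eq_abs]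
        have hq := hy q
        split_ifs with hB hqF hqF
        · refine mul_le_one₀ (abs_le.mpr ⟨?_, ?_⟩) (apply_nonneg p _) (hu _ _) <;>
            linarith [hq.1, hq.2]
        · rcases hint q hqF with h | h
          · have := hB0 _ hB
            simp [h] at this
          · simp [h]
        · refine mul_le_one₀ (abs_le.mpr ⟨?_, ?_⟩) (apply_nonneg p _) (hu _ _) <;>
            linarith [hq.1, hq.2]
        · rcases hint q hqF with h | h
          · simp [h]
          · exact absurd (hB1 q.1 (by simpa using h)) hB
    _ = #F := by simp
    _ ≤ 2 * Module.finrank ℝ E := by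
        have : #F ≤ 2 * Module.finrank ℝ E := by omega
        exact_mod_cast this

open Finset in
/-- If the total sum of equally large color classes has size at most six times the dimension, then
the classes can be listed so that all transversal sums obey the same bound. -/
theorem exists_listing_transversal_sum_le {κ ι E : Type*} [Fintype κ] [Fintype ι] [DecidableEq ι]
    [AddCommGroup E] [Module ℝ E] [FiniteDimensional ℝ E] (p : Seminorm ℝ E) (u : κ → ι → E)
    (hu : ∀ j i, p (u j i) ≤ 1) (a : ℕ) (A : κ → Finset ι) (hA : ∀ j, #(A j) = a)
    (hsum : p (∑ j, ∑ i ∈ A j, u j i) ≤ 6 * Module.finrank ℝ E) :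
    ∃ f : κ → Fin a → ι, (∀ j, Function.Injective (f j)) ∧ (∀ j r, f j r ∈ A j) ∧
      ∀ r, p (∑ j, u j (f j r)) ≤ 6 * Module.finrank ℝ E := by
  induction a using Nat.strong_induction_on generalizing A with
  | _ a ih =>
  rcases Nat.lt_or_ge a 2 with ha | ha
  · interval_cases a
    · exact ⟨fun _ => Fin.elim0, fun _ i => i.elim0, fun _ i => i.elim0, fun i => i.elim0⟩
    · choose g hg using fun j => card_eq_one.mp (hA j)
      refine ⟨fun j _ => g j, fun j => Function.injective_of_subsingleton _, by simp [hg],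
        fun _ => ?_⟩
      simpa [hg] using hsum
  -- Each part has at most 2/3 of the elements (attained at size 3), and 6 is the fixed point of `t
  -- ↦ 2 + 2 / 3 * t`.
  obtain ⟨b, b', rfl, hb, hb', h1, h2⟩ :
      ∃ b b', a = b + b' ∧ 0 < b ∧ 0 < b' ∧ b ≤ 2 * b' ∧ b' ≤ 2 * b :=
    ⟨a / 2, a - a / 2, by omega, by omega, by omega, by omega, by omega⟩
  obtain ⟨B, hBA, hB, herr⟩ := exists_balanced_selection p u hu b b' (by omega) A hA
  set S := ∑ j, ∑ i ∈ A j, u j i with hS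
  set D : ℝ := (Module.finrank ℝ E : ℝ)
  have hbpos : (0 : ℝ) < (b : ℝ) + b' := by positivity
  have hcompl : ∑ j, ∑ i ∈ A j \ B j, u j i = S - ∑ j, ∑ i ∈ B j, u j i := by
    rw [hS, ← sum_sub_distrib]
    refine sum_congr rfl fun j _ => ?_
    rw [eq_sub_iff_add_eq, sum_sdiff (hBA j)]
  have hbound : ∀ (t : ℝ) (w : E), 0 ≤ t → t ≤ 2 / 3 → p (w - t • S) ≤ 2 * D → p w ≤ 6 * D := by
    intro t w ht ht' hw
    calc p w = p ((w - t • S) + t • S) := by rw [sub_add_cancel]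
      _ ≤ p (w - t • S) + p (t • S) := map_add_le_add p _ _
      _ = p (w - t • S) + t * p S := by rw [map_smul_eq_mul, Real.norm_of_nonneg ht]
      _ ≤ 2 * D + 2 / 3 * (6 * D) :=
        add_le_add hw (mul_le_mul ht' hsum (apply_nonneg p _) (by norm_num))
      _ = 6 * D := by ring
  have h1' : (b : ℝ) ≤ 2 * b' := by exact_mod_cast h1
  have h2' : (b' : ℝ) ≤ 2 * b := by exact_mod_cast h2
  obtain ⟨f, hf, hfB, hfp⟩ := ih b (by omega) B hB
    (hbound _ _ (by positivity) (by rw [div_le_div_iff₀ hbpos (by norm_num)]; linarith) herr)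
  obtain ⟨g, hg, hgB, hgp⟩ := ih b' (by omega) (fun j => A j \ B j)
    (fun j => by rw [card_sdiff_of_subset (hBA j), hA, hB]; omega)
    (hbound ((b' : ℝ) / (b + b')) _ (by positivity)
      (by rw [div_le_div_iff₀ hbpos (by norm_num)]; linarith) (by
        rw [hcompl, ← map_neg_eq_map p]
        convert herr using 2
        have : (b' : ℝ) / (b + b') = 1 - b / (b + b') := by field_simp; ring
        rw [this]
        module))
  refine ⟨fun j => Fin.append (f j) (g j), fun j => ?_, fun j r => ?_, fun r => ?_⟩
  · refine Fin.append_injective_iff.mpr ⟨hf j, hg j, fun x y h => ?_⟩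
    exact (mem_sdiff.mp (hgB j y)).2 (h ▸ hfB j x)
  · refine Fin.addCases (fun x => ?_) (fun x => ?_) r
    · simpa using hBA j (hfB j x)
    · simpa using (mem_sdiff.mp (hgB j x)).1
  · refine Fin.addCases (fun x => ?_) (fun x => ?_) r
    · simpa using hfp x
    · simpa using hgp x

/-! ### The colorful theorem -/

theorem theorem2 (d m n : ℕ)
    (p : Seminorm ℝ (Fin d → ℝ)) (hp : ∀ x : Fin d → ℝ, p x = 0 → x = 0)
    (u : Fin n → Fin m → (Fin d → ℝ))
    (hu : ∀ j i, u j i ∈ p.closedBall 0 1)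
    (hsum : ∑ j : Fin n, ∑ i : Fin m, u j i = 0) :
    ∃ π : Fin n → Equiv.Perm (Fin m), ∀ k : Fin m,
      p (∑ i ∈ Finset.Iic k, ∑ j : Fin n, u j (π j i)) ≤
        min ((n : ℝ) * (d : ℝ)) (40 * (d : ℝ) ^ 5) := by
  have hu1 : ∀ j i, p (u j i) ≤ 1 := fun j i => by simpa [Seminorm.mem_closedBall] using hu j i
  have hfr : Module.finrank ℝ (Fin d → ℝ) = d := by simp
  rcases le_total ((n : ℝ) * d) (40 * (d : ℝ) ^ 5) with hle | hle
  · rw [min_eq_left hle]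
    choose π hπ using fun j =>
      exists_perm_seminorm_partial_sum_sub_le p zero_le_one (u j) (hu1 j)
    refine ⟨π, fun k => ?_⟩
    set c : ℝ := ((k + 1 - Module.finrank ℝ (Fin d → ℝ) : ℕ) : ℝ) / m
    have hrep : ∑ i ∈ Finset.Iic k, ∑ j, u j (π j i) =
        ∑ j, (∑ i ∈ Finset.Iic k, u j (π j i) - c • ∑ i, u j i) := by
      rw [Finset.sum_sub_distrib, ← Finset.smul_sum, hsum, smul_zero, sub_zero, Finset.sum_comm]
    rw [hrep]
    refine (Finset.le_sum_of_subadditive p (map_zero p).le (map_add_le_add p) _ _).trans ?_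
    refine (Finset.sum_le_card_nsmul _ _ (d : ℝ) fun j _ => ?_).trans (by simp)
    simpa [c] using hπ j k
  · rw [min_eq_right hle]
    -- The whole family sums to zero, so the splitting can start from the full classes.
    obtain ⟨f, hf, -, hfp⟩ := exists_listing_transversal_sum_le p u hu1 m
      (fun _ => Finset.univ) (by simp) (by rw [hsum, map_zero]; positivity)
    let σ : Fin n → Equiv.Perm (Fin m) := fun j =>
      Equiv.ofBijective (f j) (Finite.injective_iff_bijective.mp (hf j))
    have hσ : ∑ r, ∑ j, u j (f j r) = 0 := by
      rw [Finset.sum_comm, ← hsum]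
      exact Finset.sum_congr rfl fun j _ => Equiv.sum_comp (σ j) (u j)
    obtain ⟨τ, hτ⟩ := exists_perm_seminorm_partial_sum_sub_le p (by positivity)
      (fun r => ∑ j, u j (f j r)) hfp
    -- One common `τ` reorders the transversals as blocks.
    refine ⟨fun j => τ.trans (σ j), fun k => ?_⟩
    have h := hτ k
    rw [hσ, smul_zero, sub_zero, hfr] at h
    refine h.trans ?_
    rcases Nat.eq_zero_or_pos d with rfl | hd
    · simp
    · have hd1 : (1 : ℝ) ≤ d := by exact_mod_cast hd
      have := pow_le_pow_right₀ hd1 (show 2 ≤ 5 by norm_num)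
      nlinarith [sq_nonneg (d : ℝ)]
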